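/- Let $K$ be a finite subset of the closed unit disc in $\mathbb C$, let $\mathbb N=\{1,2,\dots\}$, and let $T$ be the left shift on $K^{\mathbb N}$ (product topology, Borel $\sigma$-algebra). An invariant measure is a $T$-invariant Borel probability measure on $K^{\mathbb N}$, and an ergodic measure is an ergodic invariant measure. * For blocks $A=(a_1,\dots,a_n)$, $B=(b_1,\dots,b_n)$ of complex numbers put $$\mathrm{corr}(A,B)=\frac1n\sum_{i=1}^n a_i\overline{b_i}-\Bigl(\frac1n\sum_{i=1}^n a_i\Bigr)\Bigl(\frac1n\sum_{i=1}^n\overline{b_i}\Bigr).$$ Sequences $x,y\in K^{\mathbb N}$ are weakly correlated if $\limsup_n|\mathrm{corr}((x_1,\dots,x_n),(y_1,\dots,y_n))|>0$. * A sequence $y\in K^{\mathbb N}$ is generic for an invariant measure $\nu$ if $\frac1n\sum_{i=1}^n f(T^iy)\to\int f\,d\nu$ for every continuous $f:K^{\mathbb N}\to\mathbb C$. * A sequence $x\in K^{\mathbb N}$ semi-generates (is semi-generic for) an invariant measure $\mu$ if there is a strictly increasing sequence $(n_k)$ of non-negative integers such that for every $m\ge1$ and every block $B\in K^m$ $$\lim_k\frac1{n_k}\#\{1\le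 i\le n_k: (x_i,\dots,x_{i+m-1})=B\}=\mu(\{z: (z_1,\dots,z_m)=B\}).$$ * Invariant measures $\mu,\nu$ are correlated if $$\sup_\xi\Bigl|\int x_1\overline{y_1}\,d\xi(x,y)-\int x_1\,d\mu(x)\int\overline{y_1}\,d\nu(y)\Bigr|\neq0,$$ where $\xi$ ranges over all joinings of $\mu$ and $\nu$, that is, over all $T\times T$-invariant Borel probability measures on $K^{\mathbb N}\times K^{\mathbb N}$ with marginals $\mu$ and $\nu$. Theorem. A sequence $x\in K^{\mathbb N}$ is weakly correlated to some sequence $y\in K^{\mathbb N}$ that is generic for an ergodic measure if and only if $x$ semi-generates at least one invariant measure that is correlated to an ergodic measure. -/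

import Mathlib

open Filter Topology MeasureTheory
open scoped ComplexConjugate

/-! Sequences `x₁, x₂, …` are functions `x : ℕ → _`, the term `x i` being the `(i+1)`-st symbol,
so `x 0` is the first symbol. -/

namespace SeqCorr

noncomputable section

/-- The correlation of two complex blocks of the same length `n`. -/
def blockCorr {n : ℕ} (A B : Fin n → ℂ) : ℂ :=
  (1 / (n : ℂ)) * ∑ i, A i * conj (B i)
    - ((1 / (n : ℂ)) * ∑ i, A i) * ((1 / (n : ℂ)) * ∑ i, conj (B i))

/-- The initial block consisting of the first `n` symbols of a sequence. -/
def initialBlock {α : Type*} (x : ℕ → α) (n : ℕ) : Fin n → α := fun i => x i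

/-- Weak correlation of two (bounded) complex sequences: the limsup of the moduli of the
correlations of the initial blocks is positive. -/
def WeaklyCorrelated (x y : ℕ → ℂ) : Prop :=
  0 < limsup (fun n : ℕ => ‖blockCorr (initialBlock x n) (initialBlock y n)‖) atTop

/-- The left shift on sequences. -/
def shift {α : Type*} (x : ℕ → α) : ℕ → α := fun i => x (i + 1)

/-- `μ` is a `T`-invariant probability measure. -/
structure IsInvariantMeasure {X : Type*} [MeasurableSpace X] (T : X → X) (μ : Measure X) :
    Prop where
  isProbabilityMeasure : IsProbabilityMeasure μ
  measurePreserving : MeasurePreserving T μ μ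

/-- `μ` is an ergodic `T`-invariant probability measure. -/
structure IsErgodicMeasure {X : Type*} [MeasurableSpace X] (T : X → X) (μ : Measure X) :
    Prop where
  isProbabilityMeasure : IsProbabilityMeasure μ
  ergodic : Ergodic T μ

/-- The point `x` of the topological dynamical system `(X, T)` is generic for `μ`. -/
def IsGeneric {X : Type*} [TopologicalSpace X] [MeasurableSpace X] (T : X → X) (x : X)
    (μ : Measure X) : Prop :=
  ∀ f : C(X, ℂ),
    Tendsto (fun n : ℕ => (1 / (n : ℂ)) * ∑ i ∈ Finset.Icc 1 n, f (T^[i] x)) atTop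
      (𝓝 (∫ z, f z ∂μ))

/-- The cylinder set of all sequences that start with the block `B`. -/
def cylinder {α : Type*} {m : ℕ} (B : Fin m → α) : Set (ℕ → α) :=
  {z | ∀ j : Fin m, z j = B j}

open Classical in
/-- The number of occurrences of the block `B` in `x` starting at one of the first `n`
positions. -/
def occurrences {α : Type*} {m : ℕ} (x : ℕ → α) (B : Fin m → α) (n : ℕ) : ℕ :=
  ((Finset.range n).filter fun i => ∀ j : Fin m, x (i + j) = B j).card

/-- `x` semi-generates `μ` along the subsequence `(n k)`. -/
def SemiGeneratesAlong {α : Type*} [MeasurableSpace α] (x : ℕ → α) (μ : Measure (ℕ → α))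
    (n : ℕ → ℕ) : Prop :=
  ∀ m : ℕ, 0 < m → ∀ B : Fin m → α,
    Tendsto (fun k : ℕ => (1 / (n k : ℝ)) * (occurrences x B (n k) : ℝ)) atTop
      (𝓝 (μ.real (cylinder B)))

/-- `x` is semi-generic for `μ`: it semi-generates `μ` along some subsequence. -/
def SemiGenerates {α : Type*} [MeasurableSpace α] (x : ℕ → α) (μ : Measure (ℕ → α)) : Prop :=
  ∃ n : ℕ → ℕ, StrictMono n ∧ SemiGeneratesAlong x μ n

/-- `ξ` is a joining of the shift-invariant measures `μ` and `ν`: it is invariant under the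
product of the shifts and has marginals `μ` and `ν`. -/
structure IsJoining {α : Type*} [MeasurableSpace α] (ξ : Measure ((ℕ → α) × (ℕ → α)))
    (μ ν : Measure (ℕ → α)) : Prop where
  invariant : IsInvariantMeasure (Prod.map shift shift) ξ
  map_fst : ξ.map Prod.fst = μ
  map_snd : ξ.map Prod.snd = ν

/-- The covariance of the first symbols under a measure `ξ` with marginals `μ` and `ν`. -/
def joiningCorr {K : Finset ℂ} (ξ : Measure ((ℕ → K) × (ℕ → K))) (μ ν : Measure (ℕ → K)) : ℂ :=
  (∫ p, (p.1 0 : ℂ) * conj (p.2 0 : ℂ) ∂ξ)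
    - (∫ z, (z 0 : ℂ) ∂μ) * ∫ z, conj (z 0 : ℂ) ∂ν

/-- The correlation of two shift-invariant measures on `K^ℕ`: the supremum, over all joinings,
of the modulus of the covariance of the first symbols. -/
def measureCorr {K : Finset ℂ} (μ ν : Measure (ℕ → K)) : ℝ :=
  sSup {r : ℝ | ∃ ξ : Measure ((ℕ → K) × (ℕ → K)), IsJoining ξ μ ν ∧ r = ‖joiningCorr ξ μ ν‖}

/-- Two shift-invariant measures on `K^ℕ` are correlated. -/
def MeasuresCorrelated {K : Finset ℂ} (μ ν : Measure (ℕ → K)) : Prop :=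
  measureCorr μ ν ≠ 0

end

end SeqCorr

/-! From sequences to measures: along times at which the correlation of `x` and `y` stays above some
`c > 0`, the empirical measures of the orbit of `(x, y)` have a weak limit `ξ`
(`exists_subseq_tendsto_averages`). Genericity of `y` forces the second marginal to be `ν`; the
first is semi-generated by `x`. The covariance under `ξ` is a limit of block correlations, hence
nonzero.

From measures to sequences: let `ξ` be a joining with nonzero covariance. After a rotation, `y` must
be generic for `ν` and have averages of a real score `f (x i) (y i)` nearly as large as `∫ f dξ`
infinitely often. By ergodicity, for large `L` most of `ν` sits on sequences whose first `L` symbols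
have almost the block statistics of `ν` (`tendsto_measure_typicalSet_compl`). Give each `L`-block of
`x` its best-scoring typical partner; on average this is almost as good as `ξ`, whose second
coordinate is mostly typical (`exists_selection`). The partners belong to overlapping windows, but
some way of cutting `ℕ` into disjoint windows does at least as well as the average
(`exists_offset`). Concatenating the partners keeps block statistics right on every long interval
(`exists_tracking`). Such sequences, with improving precision, are glued along rapidly growing
stages ending at terms of `n` (`exists_generic_tracking`): each stage dwarfs its past, so scores
survive, while discrepancies average out to give genericity. -/

namespace SeqCorr

/-! ### Shift, cylinders and truncation. -/

section Basic

variable {α : Type*}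

@[simp]
theorem shift_iterate_apply (x : ℕ → α) (i j : ℕ) : shift^[i] x j = x (i + j) := by
  induction i generalizing x with
  | zero => simp
  | succ i ih => rw [Function.iterate_succ_apply, ih]; simp only [shift]; congr 1; omega

theorem mem_cylinder_iff {m : ℕ} {B : Fin m → α} {z : ℕ → α} :
    z ∈ cylinder B ↔ initialBlock z m = B := by
  simp [cylinder, funext_iff, initialBlock]

theorem occurrences_eq_sum {m : ℕ} (x : ℕ → α) (B : Fin m → α) (n : ℕ) :
    (occurrences x B n : ℝ)
      = ∑ i ∈ Finset.range n, (cylinder B).indicator (fun _ => (1 : ℝ)) (shift^[i] x) := by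
  classical
  simp only [occurrences, Finset.card_filter, Set.indicator_apply, cylinder, Set.mem_ofPred_eq,
    shift_iterate_apply]
  push_cast
  refine Finset.sum_congr rfl fun i _ => ?_
  congr

theorem apply_initialBlock_eq_sum [Fintype α] {E : Type*} [AddCommGroup E] [Module ℝ E] {m : ℕ}
    (F : (Fin m → α) → E) (z : ℕ → α) :
    F (initialBlock z m) = ∑ B, (cylinder B).indicator (fun _ => (1 : ℝ)) z • F B := by
  classical
  simp [Set.indicator_apply, mem_cylinder_iff]

/-- The sequence that agrees with `z` on the first `m` symbols and is constant afterwards. -/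
def truncate (a : α) (m : ℕ) (z : ℕ → α) : ℕ → α := fun i => if i < m then z i else a

theorem truncate_eq_of_initialBlock (a : α) (m : ℕ) (z : ℕ → α) :
    truncate a m z = fun i => if h : i < m then initialBlock z m ⟨i, h⟩ else a := by
  ext i; simp [truncate, initialBlock]

theorem measurable_shift [MeasurableSpace α] : Measurable (shift : (ℕ → α) → ℕ → α) :=
  measurable_pi_iff.2 fun i => measurable_pi_apply (i + 1)

theorem continuous_shift [TopologicalSpace α] : Continuous (shift : (ℕ → α) → ℕ → α) :=
  continuous_pi fun i => continuous_apply (i + 1)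

theorem measurableSet_cylinder [MeasurableSpace α] [MeasurableSingletonClass α] {m : ℕ}
    (B : Fin m → α) : MeasurableSet (cylinder B) := by
  have : cylinder B = ⋂ j : Fin m, (fun z : ℕ → α => z j) ⁻¹' {B j} := by
    ext; simp [cylinder]
  rw [this]
  exact MeasurableSet.iInter fun j => measurable_pi_apply _ (measurableSet_singleton _)

theorem isClopen_cylinder [TopologicalSpace α] [DiscreteTopology α] {m : ℕ}
    (B : Fin m → α) : IsClopen (cylinder B) := by
  have : cylinder B = ⋂ j : Fin m, (fun z : ℕ → α => z j) ⁻¹' {B j} := by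
    ext; simp [cylinder]
  rw [this]
  exact isClopen_iInter_of_finite fun j => (isClopen_discrete _).preimage (continuous_apply _)

/-- The product uniformity tests finitely many coordinates, and coordinate `i` is exact as soon as
`i < m`, whatever the sequence. -/
theorem tendstoUniformly_truncate [UniformSpace α] (a : α) :
    TendstoUniformly (truncate a) id atTop := by
  rw [tendstoUniformly_iff_tendsto, Pi.uniformity, tendsto_iInf]
  intro i
  rw [tendsto_comap_iff]
  intro s hs
  rw [mem_map]
  filter_upwards [prod_mem_prod (Ioi_mem_atTop i) (univ_mem : Set.univ ∈ (⊤ : Filter (ℕ → α)))]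
  rintro ⟨m, z⟩ ⟨hm, -⟩
  have hm' : i < m := hm
  simpa [truncate, hm'] using refl_mem_uniformity hs

end Basic

/-! ### Orbit averages and block frequencies. -/

section CesaroShift

theorem sum_Icc_one_eq_sum_range {E : Type*} [AddCommMonoid E] (a : ℕ → E) (n : ℕ) :
    ∑ i ∈ Finset.Icc 1 n, a i = ∑ i ∈ Finset.range n, a (i + 1) := by
  rw [Finset.range_eq_Ico, Finset.sum_Ico_add' a 0 n 1]
  rfl

/-- Genericity averages over times `1, …, n`, block counts over `0, …, n - 1`. The difference
telescopes to two bounded terms. -/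
theorem tendsto_average_Icc_sub_range {E : Type*} [NormedAddCommGroup E] [NormedSpace ℝ E]
    (a : ℕ → E) {C : ℝ} (hC : ∀ i, ‖a i‖ ≤ C) :
    Tendsto (fun n : ℕ => (1 / (n : ℝ)) •
      (∑ i ∈ Finset.Icc 1 n, a i - ∑ i ∈ Finset.range n, a i)) atTop (𝓝 0) := by
  refine squeeze_zero_norm (a := fun n : ℕ => (1 / (n : ℝ)) * (C + C)) (fun n => ?_) ?_
  · rw [sum_Icc_one_eq_sum_range, ← Finset.sum_sub_distrib, Finset.sum_range_sub, norm_smul,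
      Real.norm_of_nonneg (by positivity)]
    gcongr
    exact (norm_sub_le _ _).trans (add_le_add (hC _) (hC _))
  · simpa using tendsto_one_div_atTop_nhds_zero_nat.mul_const (C + C)

end CesaroShift

section Generic

theorem IsGeneric.tendsto_range {X : Type*} [TopologicalSpace X] [CompactSpace X]
    [MeasurableSpace X] {T : X → X} {x : X} {μ : Measure X} (h : IsGeneric T x μ)
    (f : C(X, ℂ)) :
    Tendsto (fun n : ℕ => (1 / (n : ℝ)) • ∑ i ∈ Finset.range n, f (T^[i] x)) atTop
      (𝓝 (∫ z, f z ∂μ)) := by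
  have h1 := (h f).sub (tendsto_average_Icc_sub_range
    (fun i => f (T^[i] x)) (C := ‖f‖) fun i => f.norm_coe_le_norm _)
  rw [sub_zero] at h1
  refine h1.congr fun n => ?_
  rw [Complex.real_smul, Complex.real_smul]
  push_cast
  ring

end Generic

section Averages

variable {α : Type*} [Fintype α] [MeasurableSpace α] [MeasurableSingletonClass α]
  {E : Type*} [NormedAddCommGroup E] [NormedSpace ℝ E]

theorem integral_apply_initialBlock [CompleteSpace E] (μ : Measure (ℕ → α)) [IsFiniteMeasure μ]
    {m : ℕ} (F : (Fin m → α) → E) :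
    ∫ z, F (initialBlock z m) ∂μ = ∑ B, μ.real (cylinder B) • F B := by
  simp_rw [apply_initialBlock_eq_sum F]
  rw [integral_finsetSum]
  · refine Finset.sum_congr rfl fun B _ => ?_
    rw [integral_smul_const, integral_indicator_const _ (measurableSet_cylinder B)]
    simp
  · intro B _
    exact ((integrable_const (1 : ℝ)).indicator (measurableSet_cylinder B)).smul_const _

theorem SemiGeneratesAlong.tendsto_block [CompleteSpace E] {x : ℕ → α}
    {μ : Measure (ℕ → α)} [IsFiniteMeasure μ] {n : ℕ → ℕ} (h : SemiGeneratesAlong x μ n) {m : ℕ} (hm : 0 < m) (F : (Fin m → α) → E) :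
    Tendsto (fun k => (1 / (n k : ℝ)) • ∑ i ∈ Finset.range (n k),
      F (initialBlock (shift^[i] x) m)) atTop (𝓝 (∫ z, F (initialBlock z m) ∂μ)) := by
  rw [integral_apply_initialBlock]
  have : ∀ k, (1 / (n k : ℝ)) • ∑ i ∈ Finset.range (n k), F (initialBlock (shift^[i] x) m)
      = ∑ B, ((1 / (n k : ℝ)) * (occurrences x B (n k) : ℝ)) • F B := by
    intro k
    simp_rw [apply_initialBlock_eq_sum F]
    rw [Finset.sum_comm, Finset.smul_sum]
    refine Finset.sum_congr rfl fun B _ => ?_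
    rw [occurrences_eq_sum, ← Finset.sum_smul, smul_smul]
  simp_rw [this]
  exact tendsto_finsetSum _ fun B _ => (h m hm B).smul_const _

end Averages

section Continuous

variable {α : Type*} [Fintype α] [UniformSpace α] [DiscreteTopology α]
  [MeasurableSpace α] [BorelSpace α]
  {E : Type*} [NormedAddCommGroup E] [NormedSpace ℝ E] [CompleteSpace E]

/-- By uniform continuity on a compact space, `f` is uniformly close to a function of the first `m`
symbols, for which the claim is a finite combination of block frequencies. -/
theorem SemiGeneratesAlong.tendsto_continuous {x : ℕ → α} {μ : Measure (ℕ → α)}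
    [IsProbabilityMeasure μ] {n : ℕ → ℕ} (h : SemiGeneratesAlong x μ n) {f : (ℕ → α) → E}
    (hf : Continuous f) :
    Tendsto (fun k => (1 / (n k : ℝ)) • ∑ i ∈ Finset.range (n k), f (shift^[i] x)) atTop
      (𝓝 (∫ z, f z ∂μ)) := by
  have hmeas : ∀ m, Continuous (truncate (x 0) m : (ℕ → α) → ℕ → α) := by
    intro m
    refine continuous_pi fun i => ?_
    by_cases hi : i < m
    · simpa [truncate, hi] using continuous_apply i
    · simpa [truncate, hi] using continuous_const
  have huc : UniformContinuous f := CompactSpace.uniformContinuous_of_continuous hf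
  have hunif := huc.comp_tendstoUniformly (tendstoUniformly_truncate (x 0))
  have hint : ∀ {g : (ℕ → α) → E}, Continuous g → Integrable g μ := fun hg =>
    hg.integrable_of_hasCompactSupport (HasCompactSupport.of_compactSpace _)
  rw [Metric.tendsto_atTop]
  intro ε hε
  obtain ⟨m, hm0, hm⟩ := ((eventually_gt_atTop 0).and
    (Metric.tendstoUniformly_iff.1 hunif (ε / 4) (by positivity))).exists
  simp only [Function.comp_apply, id] at hm
  have hlim := h.tendsto_block hm0
    (fun B => f (fun i => if h : i < m then B ⟨i, h⟩ else x 0))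
  simp_rw [← truncate_eq_of_initialBlock] at hlim
  obtain ⟨k₀, hk₀⟩ := Metric.tendsto_atTop.1 hlim (ε / 4) (by positivity)
  refine ⟨k₀, fun k hk => ?_⟩
  have h1 := hk₀ k hk
  have h2 : dist ((1 / (n k : ℝ)) • ∑ i ∈ Finset.range (n k), f (shift^[i] x))
      ((1 / (n k : ℝ)) • ∑ i ∈ Finset.range (n k), f (truncate (x 0) m (shift^[i] x)))
      ≤ ε / 4 := by
    rw [dist_eq_norm, ← smul_sub, ← Finset.sum_sub_distrib, norm_smul]
    have : ‖∑ i ∈ Finset.range (n k), (f (shift^[i] x) - f (truncate (x 0) m (shift^[i] x)))‖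
        ≤ n k * (ε / 4) := by
      refine (norm_sum_le_of_le _ fun i _ => ?_).trans_eq
        (by rw [Finset.sum_const, Finset.card_range, nsmul_eq_mul])
      rw [← dist_eq_norm]
      exact (hm _).le
    rcases Nat.eq_zero_or_pos (n k) with h0 | h0
    · simp [h0]; positivity
    · have h0' : (0 : ℝ) < n k := by exact_mod_cast h0
      rw [Real.norm_of_nonneg (by positivity), div_mul_eq_mul_div, one_mul, div_le_iff₀ h0']
      linarith
  have h3 : dist (∫ z, f z ∂μ) (∫ z, f (truncate (x 0) m z) ∂μ) ≤ ε / 4 := by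
    rw [dist_eq_norm, ← integral_sub (hint hf)
      (hint (g := fun z => f (truncate (x 0) m z)) (hf.comp (hmeas m)))]
    refine (norm_integral_le_of_norm_le_const (C := ε / 4)
      (Eventually.of_forall fun z => ?_)).trans_eq (by simp)
    rw [← dist_eq_norm]
    exact (hm z).le
  refine (dist_triangle4 _
    ((1 / (n k : ℝ)) • ∑ i ∈ Finset.range (n k), f (truncate (x 0) m (shift^[i] x)))
    (∫ z, f (truncate (x 0) m z) ∂μ) _).trans_lt ?_
  rw [dist_comm (∫ z, f (truncate (x 0) m z) ∂μ)]
  linarith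

/-- A point whose orbit has the right block frequencies is generic. -/
theorem SemiGeneratesAlong.isGeneric {x : ℕ → α} {μ : Measure (ℕ → α)}
    [IsProbabilityMeasure μ] (h : SemiGeneratesAlong x μ id) : IsGeneric shift x μ := by
  intro f
  have h1 := (h.tendsto_continuous f.continuous).add (tendsto_average_Icc_sub_range
    (fun i => f (shift^[i] x)) (C := ‖f‖) fun i => f.norm_coe_le_norm _)
  rw [add_zero] at h1
  refine h1.congr fun n => ?_
  rw [id, ← smul_add, Complex.real_smul, add_sub_cancel]
  push_cast
  rfl

end Continuous

/-! ### Empirical measures and their weak limits. -/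

section Empirical

variable {Z : Type*} [MeasurableSpace Z]

/-- The empirical measure of the first `n + 1` points of the orbit of `p`. -/
noncomputable def empiricalMeasure (S : Z → Z) (p : Z) (n : ℕ) : Measure Z :=
  (n + 1 : ENNReal)⁻¹ • ∑ i ∈ Finset.range (n + 1), Measure.dirac (S^[i] p)

instance isProbabilityMeasure_empiricalMeasure (S : Z → Z) (p : Z) (n : ℕ) :
    IsProbabilityMeasure (empiricalMeasure S p n) := by
  constructor
  simp only [empiricalMeasure, Measure.smul_apply, Measure.finsetSum_apply, measure_univ,
    Finset.sum_const, Finset.card_range, smul_eq_mul, nsmul_eq_mul, mul_one]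
  push_cast
  exact ENNReal.inv_mul_cancel (by simp) (by finiteness)

variable [TopologicalSpace Z] [OpensMeasurableSpace Z]
  {E : Type*} [NormedAddCommGroup E] [NormedSpace ℝ E] [CompleteSpace E]
  [MeasurableSpace E] [BorelSpace E] [SecondCountableTopology E]

theorem integral_empiricalMeasure (S : Z → Z) (p : Z) (n : ℕ) {f : Z → E}
    (hf : Continuous f) :
    ∫ z, f z ∂(empiricalMeasure S p n)
      = (1 / ((n + 1 : ℕ) : ℝ)) • ∑ i ∈ Finset.range (n + 1), f (S^[i] p) := by
  have hsm : StronglyMeasurable f := hf.measurable.stronglyMeasurable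
  rw [empiricalMeasure, integral_smul_measure, integral_finsetSum_measure]
  · simp only [integral_dirac' _ _ hsm]
    congr 1
    rw [ENNReal.toReal_inv, one_div]
    congr 1
    rw [ENNReal.toReal_add (by finiteness) (by finiteness)]
    simp
  · intro i _
    exact integrable_dirac' hsm (by simp)

end Empirical

section Compactness

variable {Z : Type*} [TopologicalSpace Z] [CompactSpace Z] [TopologicalSpace.MetrizableSpace Z]
  [MeasurableSpace Z] [BorelSpace Z]

theorem exists_subseq_tendsto_averages (S : Z → Z) (hS : Continuous S) (p : Z) {φ : ℕ → ℕ}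
    (hφ : StrictMono φ) (hpos : ∀ k, 0 < φ k) :
    ∃ ψ : ℕ → ℕ, StrictMono ψ ∧ ∃ ξ : Measure Z, IsInvariantMeasure S ξ ∧
      ∀ f : C(Z, ℂ), Tendsto (fun k => (1 / (φ (ψ k) : ℝ)) •
        ∑ i ∈ Finset.range (φ (ψ k)), f (S^[i] p)) atTop (𝓝 (∫ z, f z ∂ξ)) := by
  -- `empiricalMeasure S p n` averages `n + 1` points, hence the `- 1`.
  let P : ℕ → ProbabilityMeasure Z := fun k => ⟨empiricalMeasure S p (φ k - 1), inferInstance⟩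
  obtain ⟨ξ, ψ, hψ, hlim⟩ := CompactSpace.tendsto_subseq P
  have key : ∀ f : C(Z, ℂ), Tendsto (fun k => (1 / (φ (ψ k) : ℝ)) •
      ∑ i ∈ Finset.range (φ (ψ k)), f (S^[i] p)) atTop (𝓝 (∫ z, f z ∂(ξ : Measure Z))) := by
    intro f
    rw [ProbabilityMeasure.tendsto_iff_forall_integral_rclike_tendsto ℂ] at hlim
    refine (hlim (BoundedContinuousFunction.mkOfCompact f)).congr fun k => ?_
    have h1 := integral_empiricalMeasure S p (φ (ψ k) - 1) f.continuous
    rw [Nat.sub_add_cancel (hpos (ψ k))] at h1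
    exact h1
  refine ⟨ψ, hψ, ξ, ⟨inferInstance, hS.measurable, ?_⟩, key⟩
  have : IsProbabilityMeasure ((ξ : Measure Z).map S) :=
    Measure.isProbabilityMeasure_map hS.measurable.aemeasurable
  refine ext_of_forall_integral_eq_of_IsFiniteMeasure fun f => ?_
  let g : C(Z, ℂ) := ⟨fun z => (f z : ℂ), by fun_prop⟩
  have h1 := key g
  have h2 := key ⟨fun z => g (S z), by fun_prop⟩
  have h3 := h1.add ((tendsto_average_Icc_sub_range (fun i => g (S^[i] p)) (C := ‖g‖)
    fun i => g.norm_coe_le_norm _).comp (hφ.comp hψ).tendsto_atTop)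
  -- Invariance: the averages of `g ∘ S` and `g` differ only by boundary terms.
  have h4 : ∫ z, g (S z) ∂(ξ : Measure Z) = ∫ z, g z ∂(ξ : Measure Z) := by
    refine tendsto_nhds_unique h2 ?_
    rw [add_zero] at h3
    refine h3.congr fun k => ?_
    simp only [Function.comp_apply, ← smul_add, add_sub_cancel, sum_Icc_one_eq_sum_range,
      Function.iterate_succ_apply', ContinuousMap.coe_mk]
  rw [integral_map hS.measurable.aemeasurable f.continuous.aestronglyMeasurable]
  simp only [g, ContinuousMap.coe_mk, integral_complex_ofReal] at h4
  exact_mod_cast h4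

end Compactness

theorem prodMap_iterate {X Y : Type*} (S : X → X) (T : Y → Y) (p : X × Y) (i : ℕ) :
    (Prod.map S T)^[i] p = (S^[i] p.1, T^[i] p.2) := by
  rw [Prod.map_iterate]; rfl

/-! ### From weak correlation of sequences to correlation of measures. -/

section Forward

variable {K : Finset ℂ}

/-- The first symbol, as a continuous function. -/
def firstSymbol (K : Finset ℂ) : C(ℕ → K, ℂ) := ⟨fun z => (z 0 : ℂ), by fun_prop⟩

theorem blockCorr_initialBlock (x y : ℕ → ℂ) (n : ℕ) :
    blockCorr (initialBlock x n) (initialBlock y n)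
      = (1 / (n : ℝ)) • ∑ i ∈ Finset.range n, x i * conj (y i)
        - ((1 / (n : ℝ)) • ∑ i ∈ Finset.range n, x i)
          * ((1 / (n : ℝ)) • ∑ i ∈ Finset.range n, conj (y i)) := by
  simp only [blockCorr, initialBlock, Complex.real_smul, Finset.sum_range]
  push_cast
  rfl

/-- The orbit averages of a sequence determine the measure it semi-generates. -/
theorem semiGeneratesAlong_of_tendsto {x : ℕ → K} {μ : Measure (ℕ → K)} [IsFiniteMeasure μ]
    {n : ℕ → ℕ} (h : ∀ f : C(ℕ → K, ℂ), Tendsto (fun k => (1 / (n k : ℝ)) •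
        ∑ i ∈ Finset.range (n k), f (shift^[i] x)) atTop (𝓝 (∫ z, f z ∂μ))) :
    SemiGeneratesAlong x μ n := by
  intro m _ B
  let g : C(ℕ → K, ℂ) := ⟨(cylinder B).indicator fun _ => 1,
    (isClopen_cylinder B).continuous_indicator continuous_const⟩
  have h1 := h g
  have h2 : ∀ z, g z = (((cylinder B).indicator (fun _ => (1 : ℝ)) z : ℝ) : ℂ) := by
    intro z
    by_cases hz : z ∈ cylinder B <;> simp [g, hz]
  simp only [h2, integral_complex_ofReal] at h1
  rw [integral_indicator_const _ (measurableSet_cylinder B), smul_eq_mul, mul_one] at h1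
  have h3 := (Complex.continuous_re.tendsto _).comp h1
  rw [Complex.ofReal_re] at h3
  refine h3.congr fun k => ?_
  rw [occurrences_eq_sum, Function.comp_apply, Complex.real_smul, ← Complex.ofReal_sum,
    ← Complex.ofReal_mul, Complex.ofReal_re]

theorem norm_average_le {x : ℕ → ℂ} (hx : ∀ i, ‖x i‖ ≤ 1) (n : ℕ) :
    ‖(1 / (n : ℝ)) • ∑ i ∈ Finset.range n, x i‖ ≤ 1 := by
  rw [norm_smul, Real.norm_of_nonneg (by positivity), one_div]
  calc _ ≤ (n : ℝ)⁻¹ * n := by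
        gcongr
        exact (norm_sum_le_of_le _ fun i _ => hx i).trans_eq (by simp)
    _ ≤ 1 := inv_mul_le_one

theorem norm_blockCorr_le {x y : ℕ → ℂ} (hx : ∀ i, ‖x i‖ ≤ 1) (hy : ∀ i, ‖y i‖ ≤ 1) (n : ℕ) :
    ‖blockCorr (initialBlock x n) (initialBlock y n)‖ ≤ 2 := by
  rw [blockCorr_initialBlock]
  refine (norm_sub_le _ _).trans ?_
  rw [norm_mul]
  have h1 := norm_average_le (x := fun i => x i * conj (y i)) (fun i => by
    rw [norm_mul, RCLike.norm_conj]; exact mul_le_one₀ (hx i) (norm_nonneg _) (hy i)) n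
  have h2 := norm_average_le hx n
  have h3 := norm_average_le (x := fun i => conj (y i)) (fun i => by
    rw [RCLike.norm_conj]; exact hy i) n
  have := mul_le_one₀ h2 (norm_nonneg _) h3
  linarith

theorem norm_joiningCorr_le (hK : ∀ z ∈ K, ‖z‖ ≤ 1) {ξ : Measure ((ℕ → K) × (ℕ → K))}
    {μ ν : Measure (ℕ → K)} [IsProbabilityMeasure ξ] [IsProbabilityMeasure μ]
    [IsProbabilityMeasure ν] : ‖joiningCorr ξ μ ν‖ ≤ 2 := by
  have hK' : ∀ z : K, ‖(z : ℂ)‖ ≤ 1 := fun z => hK z z.2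
  have h1 : ‖∫ p, (p.1 0 : ℂ) * conj (p.2 0 : ℂ) ∂ξ‖ ≤ 1 :=
    (norm_integral_le_of_norm_le_const (C := 1) (Eventually.of_forall fun p => by
      rw [norm_mul, RCLike.norm_conj]
      exact mul_le_one₀ (hK' _) (norm_nonneg _) (hK' _))).trans_eq (by simp)
  have h2 : ‖∫ z, (z 0 : ℂ) ∂μ‖ ≤ 1 :=
    (norm_integral_le_of_norm_le_const (C := 1) (Eventually.of_forall fun p =>
      hK' _)).trans_eq (by simp)
  have h3 : ‖∫ z, conj (z 0 : ℂ) ∂ν‖ ≤ 1 :=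
    (norm_integral_le_of_norm_le_const (C := 1) (Eventually.of_forall fun p => by
      rw [RCLike.norm_conj]; exact hK' _)).trans_eq (by simp)
  refine (norm_sub_le _ _).trans ?_
  rw [norm_mul]
  have := mul_le_one₀ h2 (norm_nonneg _) h3
  linarith

theorem measuresCorrelated_of_joiningCorr_ne_zero (hK : ∀ z ∈ K, ‖z‖ ≤ 1)
    {ξ : Measure ((ℕ → K) × (ℕ → K))} {μ ν : Measure (ℕ → K)} [IsProbabilityMeasure μ]
    [IsProbabilityMeasure ν] (hξ : IsJoining ξ μ ν) (h : joiningCorr ξ μ ν ≠ 0) :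
    MeasuresCorrelated μ ν := by
  have hle : ‖joiningCorr ξ μ ν‖ ≤ measureCorr μ ν := by
    -- The bound is essential: a real `sSup` of an unbounded set is `0` by convention.
    refine le_csSup ⟨2, ?_⟩ ⟨ξ, hξ, rfl⟩
    rintro _ ⟨ζ, hζ, rfl⟩
    have := hζ.invariant.isProbabilityMeasure
    exact norm_joiningCorr_le hK
  exact ((norm_pos_iff.2 h).trans_le hle).ne'

theorem exists_joiningCorr_ne_zero {μ ν : Measure (ℕ → K)} (h : MeasuresCorrelated μ ν) :
    ∃ ξ, IsJoining ξ μ ν ∧ joiningCorr ξ μ ν ≠ 0 := by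
  by_contra! hcon
  refine h (le_antisymm (Real.sSup_le ?_ le_rfl) (Real.sSup_nonneg ?_)) <;>
  · rintro _ ⟨ξ, hξ, rfl⟩
    simp [hcon ξ hξ]

theorem exists_correlated_of_weaklyCorrelated (hK : ∀ z ∈ K, ‖z‖ ≤ 1) {x y : ℕ → K}
    {ν : Measure (ℕ → K)} (hν : IsErgodicMeasure shift ν) (hy : IsGeneric shift y ν)
    (hxy : WeaklyCorrelated (fun i => (x i : ℂ)) (fun i => (y i : ℂ))) :
    ∃ μ : Measure (ℕ → K), IsInvariantMeasure shift μ ∧ SemiGenerates x μ ∧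
      MeasuresCorrelated μ ν := by
  have := hν.isProbabilityMeasure
  have : BorelSpace ((ℕ → K) × (ℕ → K)) := Prod.borelSpace
  obtain ⟨c, hc0, hc⟩ := exists_between hxy
  have hfreq := frequently_lt_of_lt_limsup (u := fun n : ℕ => ‖blockCorr
    (initialBlock (fun i => (x i : ℂ)) n) (initialBlock (fun i => (y i : ℂ)) n)‖)
    (IsCoboundedUnder.of_frequently_ge (a := 0)
      (Frequently.of_forall fun _ => norm_nonneg _)) hc
  obtain ⟨φ, hφ, hφc⟩ := extraction_of_frequently_atTop
    (hfreq.and_eventually (eventually_gt_atTop 0))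
  obtain ⟨ψ, hψ, ξ, hξ, hlim⟩ := exists_subseq_tendsto_averages
    (Prod.map (shift (α := K)) (shift (α := K))) (continuous_shift.prodMap continuous_shift)
    (x, y) hφ fun k => (hφc k).2
  simp only [prodMap_iterate] at hlim
  have := hξ.isProbabilityMeasure
  have hfst : ∀ f : C(ℕ → K, ℂ), Tendsto (fun k => (1 / (φ (ψ k) : ℝ)) •
      ∑ i ∈ Finset.range (φ (ψ k)), f (shift^[i] x)) atTop (𝓝 (∫ z, f z ∂(ξ.map Prod.fst))) := by
    intro f
    rw [integral_map measurable_fst.aemeasurable f.continuous.aestronglyMeasurable]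
    exact hlim (f.comp ⟨Prod.fst, continuous_fst⟩)
  -- Full averages of `y` converge, so every subsequence yields the same second marginal.
  have hsnd : ξ.map Prod.snd = ν := by
    have : IsProbabilityMeasure (ξ.map Prod.snd) :=
      Measure.isProbabilityMeasure_map measurable_snd.aemeasurable
    refine ext_of_forall_integral_eq_of_IsFiniteMeasure fun f => ?_
    let g : C(ℕ → K, ℂ) := ⟨fun z => (f z : ℂ), by fun_prop⟩
    have h1 := hlim (g.comp ⟨Prod.snd, continuous_snd⟩)
    have h2 := (hy.tendsto_range g).comp (hφ.comp hψ).tendsto_atTop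
    have h3 := tendsto_nhds_unique h1 h2
    rw [integral_map measurable_snd.aemeasurable f.continuous.aestronglyMeasurable]
    simp only [g, ContinuousMap.comp_apply, ContinuousMap.coe_mk, integral_complex_ofReal] at h3
    exact_mod_cast h3
  have hprob : IsProbabilityMeasure (ξ.map Prod.fst) :=
    Measure.isProbabilityMeasure_map measurable_fst.aemeasurable
  have hjoin : IsJoining ξ (ξ.map Prod.fst) ν := ⟨hξ, rfl, hsnd⟩
  refine ⟨ξ.map Prod.fst, ⟨hprob, measurable_shift, ?_⟩,
    ⟨φ ∘ ψ, hφ.comp hψ, semiGeneratesAlong_of_tendsto hfst⟩,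
    measuresCorrelated_of_joiningCorr_ne_zero hK hjoin ?_⟩
  · conv_rhs => rw [← hξ.measurePreserving.map_eq]
    rw [Measure.map_map measurable_shift measurable_fst,
      Measure.map_map measurable_fst hξ.measurePreserving.measurable]
    rfl
  · have h1 := hlim ⟨fun p => (p.1 0 : ℂ) * conj (p.2 0 : ℂ), by fun_prop⟩
    have h2 := hfst (firstSymbol K)
    have h3 := (hy.tendsto_range (star (firstSymbol K))).comp
      (hφ.comp hψ).tendsto_atTop
    have h4 : Tendsto (fun k => blockCorr (initialBlock (fun i => (x i : ℂ)) (φ (ψ k)))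
        (initialBlock (fun i => (y i : ℂ)) (φ (ψ k)))) atTop
        (𝓝 (joiningCorr ξ (ξ.map Prod.fst) ν)) := by
      refine (h1.sub (h2.mul h3)).congr fun k => ?_
      rw [blockCorr_initialBlock]
      simp [firstSymbol]
    have h5 := ge_of_tendsto' h4.norm fun k => (hφc (ψ k)).1.le
    exact norm_pos_iff.1 (hc0.trans_le h5)

end Forward

/-! ### The mean ergodic theorem. -/

section MeanErgodic

variable {X : Type*} [MeasurableSpace X] {T : X → X} {ν : Measure X} {f : X → ℝ}

theorem memLp_birkhoffSum (hT : MeasurePreserving T ν ν) (hf : MemLp f 2 ν) (n : ℕ) :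
    MemLp (birkhoffSum T f n) 2 ν :=
  memLp_finsetSum (f := fun i x => f (T^[i] x)) (Finset.range n)
    fun i _ => hf.comp_measurePreserving (hT.iterate i)

theorem birkhoffSum_toLp (hT : MeasurePreserving T ν ν) (hf : MemLp f 2 ν) (n : ℕ) :
    birkhoffSum (Lp.compMeasurePreserving T hT) id n (hf.toLp f)
      = (memLp_birkhoffSum hT hf n).toLp _ := by
  induction n with
  | zero =>
    rw [birkhoffSum_zero]
    refine (Lp.ext ?_).symm
    filter_upwards [MemLp.coeFn_toLp (memLp_birkhoffSum hT hf 0), Lp.coeFn_zero ℝ 2 ν]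
      with x hx hx'
    rw [hx, hx', birkhoffSum_zero]
    rfl
  | succ n ih =>
    rw [birkhoffSum_succ, ih, id, Lp.compMeasurePreserving_iterate, Lp.toLp_compMeasurePreserving,
      ← MemLp.toLp_add]
    refine MemLp.toLp_congr _ _ (Eventually.of_forall fun x => ?_)
    exact (birkhoffSum_succ T f n x).symm

/-- Convergence in measure of the Birkhoff averages of a square integrable function with respect
to an ergodic measure. -/
theorem tendstoInMeasure_birkhoffAverage [IsProbabilityMeasure ν] (hT : Ergodic T ν)
    (hf : MemLp f 2 ν) :
    TendstoInMeasure ν (fun n => birkhoffAverage ℝ T f n) atTop (fun _ => ∫ x, f x ∂ν) := by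
  have hmp := hT.toMeasurePreserving
  let U := Lp.compMeasurePreservingₗᵢ (E := ℝ) (p := 2) ℝ T hmp
  let U' : Lp ℝ 2 ν →L[ℝ] Lp ℝ 2 ν := U.toContinuousLinearMap
  have hlim := U'.tendsto_birkhoffAverage_orthogonalProjection U.norm_toContinuousLinearMap_le
    (hf.toLp f)
  set G := (U'.eqLocus (1 : Lp ℝ 2 ν →L[ℝ] Lp ℝ 2 ν)).orthogonalProjectionOnto (hf.toLp f)
  have hfix : Lp.compMeasurePreserving T hmp (G : Lp ℝ 2 ν) = G := G.2
  have hcoe : ∀ n, birkhoffAverage ℝ U' id n (hf.toLp f)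
      = ((memLp_birkhoffSum hmp hf n).const_smul ((n : ℝ)⁻¹)).toLp _ := by
    intro n
    rw [birkhoffAverage, MemLp.toLp_const_smul]
    congr 1
    exact birkhoffSum_toLp hmp hf n
  -- The limit `G` in `L²` is invariant, so constant by ergodicity; pairing with `1` below
  -- identifies the constant.
  obtain ⟨c, hc⟩ := hT.ae_eq_const_of_ae_eq_comp_ae (Lp.aestronglyMeasurable (G : Lp ℝ 2 ν))
    (by
      have := Lp.coeFn_compMeasurePreserving (G : Lp ℝ 2 ν) hmp
      rw [hfix] at this
      exact this.symm)
  have hint : ∀ n : ℕ, 0 < n → ∫ x, birkhoffAverage ℝ T f n x ∂ν = ∫ x, f x ∂ν := by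
    intro n hn
    have h1 : ∀ i, Integrable (fun x => f (T^[i] x)) ν := fun i =>
      (hf.comp_measurePreserving (hmp.iterate i)).integrable one_le_two
    have h2 : ∀ i, ∫ x, f (T^[i] x) ∂ν = ∫ x, f x ∂ν := fun i => by
      rw [← integral_map (hmp.iterate i).measurable.aemeasurable
        (by rw [(hmp.iterate i).map_eq]; exact hf.1), (hmp.iterate i).map_eq]
    simp only [birkhoffAverage, birkhoffSum, integral_smul]
    rw [integral_finsetSum _ fun i _ => h1 i]
    simp only [h2, Finset.sum_const, Finset.card_range, nsmul_eq_mul, smul_eq_mul]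
    field_simp
  have hone : ∀ g : Lp ℝ 2 ν, inner ℝ (indicatorConstLp 2 MeasurableSet.univ (by simp) (1 : ℝ)) g
      = ∫ x, g x ∂ν := by
    intro g
    rw [L2.inner_indicatorConstLp_one, setIntegral_univ]
  have hGc : c = ∫ x, f x ∂ν := by
    have h1 := (tendsto_const_nhds (x := indicatorConstLp 2 (μ := ν) MeasurableSet.univ
      (by simp) (1 : ℝ))).inner (𝕜 := ℝ) hlim
    simp only [hone] at h1
    have h2 : ∫ x, (G : Lp ℝ 2 ν) x ∂ν = c := by
      rw [integral_congr_ae hc]; simp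
    rw [h2] at h1
    refine tendsto_nhds_unique h1 (tendsto_const_nhds.congr' ?_)
    filter_upwards [eventually_gt_atTop 0] with n hn
    rw [hcoe, integral_congr_ae (MemLp.coeFn_toLp _), ← hint n hn]
    rfl
  refine (tendstoInMeasure_of_tendsto_Lp hlim).congr (fun n => ?_) ?_
  · simp only [hcoe]
    exact MemLp.coeFn_toLp _
  · rw [← hGc]
    exact hc

end MeanErgodic

/-! ### Typical sequences and discrepancy. -/

section TypicalSet

variable {α : Type*} [MeasurableSpace α] [MeasurableSingletonClass α]

/-- The deviation, over the positions in `s`, of the number of occurrences of `B` in `z` from the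
one predicted by `ν`. -/
noncomputable def discrepancy (ν : Measure (ℕ → α)) {m : ℕ} (B : Fin m → α) (s : Finset ℕ)
    (z : ℕ → α) : ℝ :=
  ∑ i ∈ s, ((cylinder B).indicator (fun _ => (1 : ℝ)) (shift^[i] z) - ν.real (cylinder B))

/-- The sequences whose initial block of length `L` has almost the same statistics of short
blocks as `ν`. -/
def typicalSet (ν : Measure (ℕ → α)) (s : ℕ) (δ : ℝ) (L : ℕ) : Set (ℕ → α) :=
  {z | ∀ m ≤ s, ∀ B : Fin m → α, |discrepancy ν B (Finset.range L) z| ≤ δ * L}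

theorem measurable_discrepancy (ν : Measure (ℕ → α)) {m : ℕ} (B : Fin m → α) (s : Finset ℕ) :
    Measurable (discrepancy ν B s) :=
  Finset.measurable_sum _ fun i _ => (((measurable_const (a := (1 : ℝ))).indicator
    (measurableSet_cylinder B)).comp (measurable_shift.iterate i)).sub_const _

variable [Fintype α]

theorem measurableSet_typicalSet (ν : Measure (ℕ → α)) (s : ℕ) (δ : ℝ) (L : ℕ) :
    MeasurableSet (typicalSet ν s δ L) := by
  simp only [typicalSet, Set.ofPred_forall]
  exact MeasurableSet.iInter fun m => MeasurableSet.iInter fun _ => MeasurableSet.iInter fun B =>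
    measurableSet_le (measurable_discrepancy ν B _).abs measurable_const

/-- Convergence in measure handles each block; only finitely many blocks have length at most `s`, so
a union bound finishes. -/
theorem tendsto_measure_typicalSet_compl {ν : Measure (ℕ → α)} (hν : IsErgodicMeasure shift ν)
    (s : ℕ) {δ : ℝ} (hδ : 0 < δ) :
    Tendsto (fun L => ν (typicalSet ν s δ L)ᶜ) atTop (𝓝 0) := by
  have := hν.isProbabilityMeasure
  have hone : ∀ q : (Σ m : Fin (s + 1), (Fin m → α)),
      Tendsto (fun L : ℕ => ν {z | δ * L < |discrepancy ν q.2 (Finset.range L) z|})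
        atTop (𝓝 0) := by
    rintro ⟨m, B⟩
    have hB := measurableSet_cylinder B
    have hf : MemLp ((cylinder B).indicator fun _ => (1 : ℝ)) 2 ν :=
      memLp_indicator_const 2 hB 1 (by simp)
    have h1 := tendstoInMeasure_birkhoffAverage hν.ergodic hf (ENNReal.ofReal δ) (by simpa)
    rw [integral_indicator_const _ hB, smul_eq_mul, mul_one] at h1
    refine tendsto_of_tendsto_of_tendsto_of_le_of_le' tendsto_const_nhds h1
      (Eventually.of_forall fun _ => zero_le) ?_
    filter_upwards [eventually_gt_atTop 0] with L hL
    refine measure_mono fun z hz => ?_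
    have hL' : (0 : ℝ) < L := by exact_mod_cast hL
    simp only [Set.mem_ofPred_eq] at hz ⊢
    rw [edist_dist]
    refine ENNReal.ofReal_le_ofReal ?_
    rw [Real.dist_eq, birkhoffAverage, birkhoffSum]
    rw [discrepancy, Finset.sum_sub_distrib, Finset.sum_const, Finset.card_range,
      nsmul_eq_mul] at hz
    have h2 : ((L : ℝ)⁻¹ • ∑ k ∈ Finset.range L, (cylinder B).indicator (fun _ => (1 : ℝ))
        (shift^[k] z) - ν.real (cylinder B)) * L
        = ∑ k ∈ Finset.range L, (cylinder B).indicator (fun _ => (1 : ℝ)) (shift^[k] z)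
          - L * ν.real (cylinder B) := by
      rw [smul_eq_mul]; field_simp
    rw [← h2, abs_mul, abs_of_pos hL'] at hz
    exact (lt_of_mul_lt_mul_right hz hL'.le).le
  have hsum := tendsto_finsetSum Finset.univ fun q _ => hone q
  rw [Finset.sum_const_zero] at hsum
  refine tendsto_of_tendsto_of_tendsto_of_le_of_le tendsto_const_nhds hsum
    (fun _ => zero_le) fun L => ?_
  refine (measure_mono fun z hz => ?_).trans (measure_biUnion_finset_le Finset.univ _)
  simp only [typicalSet, Set.mem_compl_iff, Set.mem_ofPred_eq, not_forall, not_le] at hz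
  obtain ⟨m, hm, B, hB⟩ := hz
  simp only [Finset.mem_univ, Set.iUnion_true, Set.mem_iUnion, Set.mem_ofPred_eq]
  exact ⟨⟨⟨m, Nat.lt_succ_of_le hm⟩, B⟩, hB⟩

end TypicalSet

section Discrepancy

variable {α : Type*} [MeasurableSpace α] (ν : Measure (ℕ → α)) {m : ℕ} (B : Fin m → α)

theorem discrepancy_Ico_add (z : ℕ → α) {a b c : ℕ} (hab : a ≤ b) (hbc : b ≤ c) :
    discrepancy ν B (Finset.Ico a c) z
      = discrepancy ν B (Finset.Ico a b) z + discrepancy ν B (Finset.Ico b c) z :=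
  (Finset.sum_Ico_consecutive _ hab hbc).symm

theorem discrepancy_range_shift (z : ℕ → α) (a L : ℕ) :
    discrepancy ν B (Finset.range L) (shift^[a] z)
      = discrepancy ν B (Finset.Ico a (a + L)) z := by
  rw [discrepancy, discrepancy, Finset.sum_Ico_eq_sum_range, Nat.add_sub_cancel_left]
  refine Finset.sum_congr rfl fun i _ => ?_
  rw [← Function.iterate_add_apply, add_comm i a]

theorem abs_discrepancy_le_card [IsProbabilityMeasure ν] (s : Finset ℕ) (z : ℕ → α) :
    |discrepancy ν B s z| ≤ s.card := by
  refine (Finset.abs_sum_le_sum_abs _ _).trans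
    ((Finset.sum_le_card_nsmul _ _ 1 fun i _ => ?_).trans_eq (by simp))
  have h1 := measureReal_nonneg (μ := ν) (s := cylinder B)
  have h2 := measureReal_le_one (μ := ν) (s := cylinder B)
  rw [abs_le]
  by_cases h : shift^[i] z ∈ cylinder B <;> simp [h] <;> linarith

/-- Only occurrences starting at the last `m` positions can look beyond `b`. -/
theorem abs_discrepancy_sub_le {z w : ℕ → α} {a b : ℕ} (h : ∀ i, a ≤ i → i < b → z i = w i) :
    |discrepancy ν B (Finset.Ico a b) z - discrepancy ν B (Finset.Ico a b) w| ≤ m := by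
  rw [discrepancy, discrepancy, ← Finset.sum_sub_distrib]
  have hterm : ∀ i ∈ Finset.Ico a b, |((cylinder B).indicator (fun _ => (1 : ℝ)) (shift^[i] z)
      - ν.real (cylinder B)) - ((cylinder B).indicator (fun _ => (1 : ℝ)) (shift^[i] w)
      - ν.real (cylinder B))| ≤ if b < i + m then 1 else 0 := by
    intro i hi
    rw [Finset.mem_Ico] at hi
    rw [sub_sub_sub_cancel_right]
    split_ifs with him
    · by_cases h1 : shift^[i] z ∈ cylinder B <;> by_cases h2 : shift^[i] w ∈ cylinder B <;>
        simp [h1, h2]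
    · have : shift^[i] z ∈ cylinder B ↔ shift^[i] w ∈ cylinder B := by
        simp only [cylinder, Set.mem_ofPred_eq, shift_iterate_apply]
        refine forall_congr' fun j => ?_
        rw [h (i + j) (by omega) (by omega)]
      by_cases h1 : shift^[i] z ∈ cylinder B
      · simp [h1, this.1 h1]
      · simp [h1, mt this.2 h1]
  refine (Finset.abs_sum_le_sum_abs _ _).trans ((Finset.sum_le_sum hterm).trans ?_)
  rw [← Finset.sum_filter, Finset.sum_const, nsmul_eq_mul, mul_one]
  have : (Finset.filter (fun i => b < i + m) (Finset.Ico a b)) ⊆ Finset.Ico (b - m) b := by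
    intro i hi
    simp only [Finset.mem_filter, Finset.mem_Ico] at hi ⊢
    omega
  have := Finset.card_le_card this
  rw [Nat.card_Ico] at this
  exact_mod_cast this.trans (by omega)

/-- A sequence built by concatenating blocks of length `L` of small discrepancy has small
discrepancy on all intervals. -/
theorem abs_discrepancy_le_of_blocks [IsProbabilityMeasure ν] {z : ℕ → α} {L r : ℕ} (hL : 0 < L)
    {η : ℝ} (hη : 0 ≤ η)
    (h : ∀ b, (b + r) % L = 0 → |discrepancy ν B (Finset.Ico b (b + L)) z| ≤ η * L)
    {a c : ℕ} (hac : a ≤ c) :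
    |discrepancy ν B (Finset.Ico a c) z| ≤ η * (c - a : ℝ) + 2 * L := by
  have hmul : ∀ b, (b + r) % L = 0 → ∀ q : ℕ,
      |discrepancy ν B (Finset.Ico b (b + q * L)) z| ≤ η * (q * L : ℕ) := by
    intro b hb q
    induction q with
    | zero => simp [discrepancy]
    | succ q ih =>
      rw [discrepancy_Ico_add ν B z (b := b + q * L) (by omega) (by rw [add_mul]; omega)]
      refine (abs_add_le _ _).trans ?_
      have h1 := h (b + q * L) (by
        rw [show b + q * L + r = b + r + q * L by ring, Nat.add_mul_mod_self_right, hb])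
      rw [show b + (q + 1) * L = b + q * L + L by ring]
      push_cast at ih ⊢
      linarith
  have haligned : ∀ b, (b + r) % L = 0 → b ≤ c →
      |discrepancy ν B (Finset.Ico b c) z| ≤ η * (c - b : ℝ) + L := by
    intro b hb hbc
    have hq := Nat.div_add_mod' (c - b) L
    have hlt := Nat.mod_lt (c - b) hL
    rw [discrepancy_Ico_add ν B z (b := b + (c - b) / L * L) (by omega) (by omega)]
    refine (abs_add_le _ _).trans (add_le_add ((hmul b hb _).trans ?_)
      ((abs_discrepancy_le_card ν B _ z).trans ?_))
    · rw [← Nat.cast_sub hbc]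
      gcongr
      omega
    · rw [Nat.card_Ico]
      exact_mod_cast (by omega)
  -- `a + d` is the first block boundary from `a` on. The incomplete blocks at the two ends cost at
  -- most `L` each.
  set d := (L - (a + r) % L) % L with hd
  have hdL : d < L := Nat.mod_lt _ hL
  have hal : (a + d + r) % L = 0 := by
    rw [show a + d + r = (a + r) + d by ring, hd, Nat.add_mod, Nat.mod_mod, ← Nat.add_mod,
      Nat.add_mod, ← Nat.mod_add_mod, Nat.mod_mod]
    have := Nat.mod_lt (a + r) hL
    rw [Nat.add_mod_mod, Nat.add_sub_cancel' this.le, Nat.mod_self]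
  have hca : (a : ℝ) ≤ c := by exact_mod_cast hac
  rcases le_total (a + d) c with hle | hle
  · rw [discrepancy_Ico_add ν B z (b := a + d) (by omega) hle]
    have h1 := abs_discrepancy_le_card ν B (Finset.Ico a (a + d)) z
    rw [Nat.card_Ico, Nat.add_sub_cancel_left] at h1
    have h2 := haligned _ hal hle
    have h3 : (d : ℝ) ≤ L := by exact_mod_cast hdL.le
    have h4 : η * (c - (a + d : ℕ) : ℝ) ≤ η * (c - a) := by
      push_cast
      gcongr
      linarith [(Nat.cast_nonneg d : (0 : ℝ) ≤ d)]
    refine (abs_add_le _ _).trans ?_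
    linarith
  · have h1 := abs_discrepancy_le_card ν B (Finset.Ico a c) z
    rw [Nat.card_Ico] at h1
    have h2 : ((c - a : ℕ) : ℝ) ≤ L := by exact_mod_cast (by omega)
    have h3 : 0 ≤ η * (c - a : ℝ) := mul_nonneg hη (by linarith)
    linarith [(Nat.cast_nonneg L : (0 : ℝ) ≤ L)]

end Discrepancy

/-! ### Passing from overlapping to disjoint windows. -/

section Offset

/-- The sequence obtained by cutting `ℕ` into intervals of length `L`, with offset determined by
`r`, and filling the interval that starts at `b` with the first `L` symbols of `G b`. -/
def tile {α : Type*} (G : ℕ → ℕ → α) (L r : ℕ) : ℕ → α :=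
  fun i => G (i - (i + r) % L) ((i + r) % L)

theorem tile_apply {α : Type*} (G : ℕ → ℕ → α) {L r b t : ℕ} (hb : (b + r) % L = 0) (ht : t < L) :
    tile G L r (b + t) = G b t := by
  have : (b + t + r) % L = t := by
    rw [show b + t + r = b + r + t by ring, Nat.add_mod, hb, zero_add, Nat.mod_mod,
      Nat.mod_eq_of_lt ht]
  simp [tile, this]

theorem sum_range_add_mod {E : Type*} [AddCommMonoid E] (f : ℕ → E) {L : ℕ} (hL : 0 < L) (i : ℕ) :
    ∑ r ∈ Finset.range L, f ((i + r) % L) = ∑ t ∈ Finset.range L, f t := by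
  induction i with
  | zero =>
    exact Finset.sum_congr rfl fun r hr => by
      rw [zero_add, Nat.mod_eq_of_lt (Finset.mem_range.1 hr)]
  | succ i ih =>
    rw [← ih]
    obtain ⟨l, rfl⟩ : ∃ l, L = l + 1 := ⟨L - 1, by omega⟩
    rw [Finset.sum_range_succ, Finset.sum_range_succ' (fun r => f ((i + r) % (l + 1)))]
    congr 1
    · exact Finset.sum_congr rfl fun r _ => by rw [show i + 1 + r = i + (r + 1) by ring]
    · rw [show i + 1 + l = i + 0 + (l + 1) by ring, Nat.add_mod_right]

theorem abs_sum_shift_sub_le {a : ℕ → ℝ} (ha : ∀ i, |a i| ≤ 1) (n t : ℕ) :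
    |∑ b ∈ Finset.range n, a (b + t) - ∑ i ∈ Finset.range n, a i| ≤ 2 * t := by
  induction t with
  | zero => simp
  | succ t ih =>
    have h1 : ∑ b ∈ Finset.range n, a (b + (t + 1)) - ∑ b ∈ Finset.range n, a (b + t)
        = a (n + t) - a t := by
      have h0 := Finset.sum_range_sub (fun b => a (b + t)) n
      rw [zero_add] at h0
      rw [← Finset.sum_sub_distrib, ← h0]
      exact Finset.sum_congr rfl fun b _ => by rw [show b + (t + 1) = b + 1 + t by ring]
    have h2 := abs_le.1 (ha (n + t))
    have h3 := abs_le.1 (ha t)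
    rw [abs_le] at ih ⊢
    push_cast
    constructor <;> linarith

/-- As `r` runs through the residues, position `i` plays each role `t` in a window exactly once. So
the tile scores summed over `r` equal the double sum up to `2 * t` for each `t`, and the best `r` is
at least average. -/
theorem exists_offset {α : Type*} {h : ℕ → α → ℝ} (hh : ∀ i a, |h i a| ≤ 1) (G : ℕ → ℕ → α)
    {L : ℕ} (hL : 0 < L) (n : ℕ) :
    ∃ r, ∑ b ∈ Finset.range n, ∑ t ∈ Finset.range L, h (b + t) (G b t)
      ≤ L * (∑ i ∈ Finset.range n, h i (tile G L r i)) + 2 * L * L := by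
  have h1 : ∑ r ∈ Finset.range L, ∑ i ∈ Finset.range n, h i (tile G L r i)
      = ∑ t ∈ Finset.range L, ∑ i ∈ Finset.range n, h i (G (i - t) t) := by
    -- For `i < t` the truncated `i - t` is `0`; these terms fall under the boundary error.
    rw [Finset.sum_comm, Finset.sum_comm (s := Finset.range L)]
    exact Finset.sum_congr rfl fun i _ => sum_range_add_mod (fun t => h i (G (i - t) t)) hL i
  have h2 : ∑ b ∈ Finset.range n, ∑ t ∈ Finset.range L, h (b + t) (G b t)
      ≤ ∑ t ∈ Finset.range L, (∑ i ∈ Finset.range n, h i (G (i - t) t) + 2 * L) := by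
    rw [Finset.sum_comm]
    refine Finset.sum_le_sum fun t ht => ?_
    have h3 := (abs_le.1 (abs_sum_shift_sub_le (a := fun i => h i (G (i - t) t))
      (fun i => hh _ _) n t)).2
    simp only [Nat.add_sub_cancel] at h3
    have h4 : (t : ℝ) ≤ L := by exact_mod_cast (Finset.mem_range.1 ht).le
    linarith
  rw [Finset.sum_add_distrib, ← h1, Finset.sum_const, Finset.card_range, nsmul_eq_mul] at h2
  obtain ⟨r, -, hr⟩ := Finset.exists_max_image (Finset.range L)
    (fun r => ∑ i ∈ Finset.range n, h i (tile G L r i)) ⟨0, Finset.mem_range.2 hL⟩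
  refine ⟨r, h2.trans ?_⟩
  have h5 := Finset.sum_le_card_nsmul _ _ _ hr
  rw [Finset.card_range, nsmul_eq_mul] at h5
  linarith

end Offset

/-! ### Best typical partners. -/

section Selection

variable {α : Type*} [MeasurableSpace α]

theorem measurable_initialBlock (L : ℕ) :
    Measurable (fun z : ℕ → α => initialBlock z L) :=
  measurable_pi_iff.2 fun i => measurable_pi_apply (i : ℕ)

/-- Replacing the second coordinate by the best member of a large set loses little. -/
theorem exists_selection [Fintype α] [MeasurableSingletonClass α] {W : Set (ℕ → α)}
    (hW : MeasurableSet W) (hne : W.Nonempty) {L : ℕ}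
    (φ : (Fin L → α) → (Fin L → α) → ℝ) {C : ℝ} (hφ : ∀ A A', |φ A A'| ≤ C) :
    ∃ g : (Fin L → α) → (ℕ → α), (∀ A, g A ∈ W) ∧
      ∀ (ξ : Measure ((ℕ → α) × (ℕ → α))) [IsProbabilityMeasure ξ],
        ∫ p, φ (initialBlock p.1 L) (initialBlock p.2 L) ∂ξ
          ≤ ∫ z, φ (initialBlock z L) (initialBlock (g (initialBlock z L)) L) ∂(ξ.map Prod.fst)
            + 2 * C * (ξ.map Prod.snd).real Wᶜ := by
  have hmax : ∀ A, ∃ w ∈ W, ∀ w' ∈ W, φ A (initialBlock w' L) ≤ φ A (initialBlock w L) := by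
    intro A
    obtain ⟨B, ⟨w, hw, rfl⟩, hB⟩ := Set.exists_max_image ((fun w => initialBlock w L) '' W) (φ A)
      (Set.toFinite _) (hne.image _)
    exact ⟨w, hw, fun w' hw' => hB _ ⟨w', hw', rfl⟩⟩
  choose g hgW hg using hmax
  refine ⟨g, hgW, fun ξ _ => ?_⟩
  have hm : Measurable fun z : ℕ → α =>
      φ (initialBlock z L) (initialBlock (g (initialBlock z L)) L) :=
    (Measurable.of_discrete (f := fun A => φ A (initialBlock (g A) L))).comp
      (measurable_initialBlock L)
  have hm2 : Measurable fun p : (ℕ → α) × (ℕ → α) =>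
      φ (initialBlock p.1 L) (initialBlock p.2 L) :=
    (Measurable.of_discrete (f := fun q : (Fin L → α) × (Fin L → α) => φ q.1 q.2)).comp
      (((measurable_initialBlock L).comp measurable_fst).prodMk
        ((measurable_initialBlock L).comp measurable_snd))
  have hb : ∀ {f : (ℕ → α) × (ℕ → α) → ℝ}, Measurable f → (∀ p, |f p| ≤ C) → Integrable f ξ :=
    fun hf hC => Integrable.of_bound hf.aestronglyMeasurable C (Eventually.of_forall hC)
  have hS : MeasurableSet (Prod.snd ⁻¹' Wᶜ : Set ((ℕ → α) × (ℕ → α))) := measurable_snd hW.compl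
  rw [integral_map measurable_fst.aemeasurable hm.aestronglyMeasurable, measureReal_def,
    Measure.map_apply measurable_snd hW.compl, ← measureReal_def]
  have hind : 2 * C * ξ.real (Prod.snd ⁻¹' Wᶜ)
      = ∫ p, (Prod.snd ⁻¹' Wᶜ).indicator (fun _ => 2 * C) p ∂ξ := by
    rw [integral_indicator_const _ hS, smul_eq_mul, mul_comm]
  have hi1 : Integrable (fun p : (ℕ → α) × (ℕ → α) =>
      φ (initialBlock p.1 L) (initialBlock (g (initialBlock p.1 L)) L)) ξ :=
    hb (hm.comp measurable_fst) fun p => hφ _ _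
  have hi2 : Integrable ((Prod.snd ⁻¹' Wᶜ).indicator fun _ => 2 * C) ξ :=
    (integrable_const _).indicator hS
  rw [hind, ← integral_add hi1 hi2]
  refine integral_mono (hb hm2 fun p => hφ _ _) (hi1.add hi2) fun p => ?_
  -- On `W` the inequality is maximality of the partner; off `W` two scores differ by at most `2 *
  -- C`.
  by_cases hp : p.2 ∈ W
  · simpa [hp] using hg (initialBlock p.1 L) p.2 hp
  · have h1 := abs_le.1 (hφ (initialBlock p.1 L) (initialBlock p.2 L))
    have h2 := abs_le.1 (hφ (initialBlock p.1 L) (initialBlock (g (initialBlock p.1 L)) L))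
    have h3 : (Prod.snd ⁻¹' Wᶜ).indicator (fun _ => 2 * C) p = 2 * C :=
      Set.indicator_of_mem (show p ∈ Prod.snd ⁻¹' Wᶜ from hp) _
    simp only [h3]
    linarith

end Selection

/-! ### Tracking at a single scale. -/

section Stage

variable {α : Type*} [Fintype α] [MeasurableSpace α] [MeasurableSingletonClass α]

theorem measurable_coordinates (f : α → α → ℝ) (t : ℕ) :
    Measurable fun p : (ℕ → α) × (ℕ → α) => f (p.1 t) (p.2 t) := by
  have hpair : Measurable fun p : (ℕ → α) × (ℕ → α) => (p.1 t, p.2 t) :=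
    ((measurable_pi_apply t).comp measurable_fst).prodMk
      ((measurable_pi_apply t).comp measurable_snd)
  exact (Measurable.of_discrete (f := fun q : α × α => f q.1 q.2)).comp hpair

theorem IsJoining.integral_coordinate {ξ : Measure ((ℕ → α) × (ℕ → α))} {μ ν : Measure (ℕ → α)}
    (hξ : IsJoining ξ μ ν) (f : α → α → ℝ) (t : ℕ) :
    ∫ p, f (p.1 t) (p.2 t) ∂ξ = ∫ p, f (p.1 0) (p.2 0) ∂ξ := by
  have hmp := hξ.invariant.measurePreserving.iterate t
  conv_rhs => rw [← hmp.map_eq]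
  rw [integral_map hmp.measurable.aemeasurable (measurable_coordinates f 0).aestronglyMeasurable]
  simp only [prodMap_iterate, shift_iterate_apply, add_zero]

/-- For arbitrarily large lengths taken from `n`, a sequence of small discrepancy at scale `L`
that correlates with `x` almost as well as the joining predicts. -/
theorem exists_tracking {x : ℕ → α} {μ ν : Measure (ℕ → α)} {n : ℕ → ℕ} (hn : StrictMono n)
    (hx : SemiGeneratesAlong x μ n) (hν : IsErgodicMeasure shift ν)
    {ξ : Measure ((ℕ → α) × (ℕ → α))} (hξ : IsJoining ξ μ ν) {f : α → α → ℝ}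
    (hf : ∀ a b, |f a b| ≤ 1) (s : ℕ) {δ : ℝ} (hδ : 0 < δ) :
    ∃ L : ℕ, ∀ N : ℕ, ∃ k ≥ N, ∃ z : ℕ → α,
      (∫ p, f (p.1 0) (p.2 0) ∂ξ - 4 * δ) * n k ≤ ∑ i ∈ Finset.range (n k), f (x i) (z i) ∧
      ∀ m ≤ s, ∀ B : Fin m → α, ∀ a c, a ≤ c →
        |discrepancy ν B (Finset.Ico a c) z| ≤ 2 * δ * (c - a : ℝ) + 2 * L := by
  have hξp := hξ.invariant.isProbabilityMeasure
  have hνp := hν.isProbabilityMeasure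
  have hμp : IsProbabilityMeasure μ := by
    rw [← hξ.map_fst]
    exact Measure.isProbabilityMeasure_map measurable_fst.aemeasurable
  set R := ∫ p, f (p.1 0) (p.2 0) ∂ξ with hR
  -- `s ≤ δ * L` absorbs occurrences cut by block boundaries; the bound `1` in the minimum makes `W`
  -- nonempty.
  obtain ⟨L, ⟨hL0, hLs⟩, hLν⟩ := ((eventually_gt_atTop 0).and
    (tendsto_natCast_atTop_atTop.eventually_ge_atTop (s / δ : ℝ))).and
    ((tendsto_measure_typicalSet_compl hν s hδ).eventually_lt_const
      (u := min (ENNReal.ofReal δ) 1) (by simpa using hδ)) |>.exists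
  have hL0' : (0 : ℝ) < L := by exact_mod_cast hL0
  set W := typicalSet ν s δ L
  have hWm : MeasurableSet W := measurableSet_typicalSet ν s δ L
  have hWne : W.Nonempty := by
    by_contra hne
    rw [Set.not_nonempty_iff_eq_empty] at hne
    rw [hne, Set.compl_empty, measure_univ] at hLν
    exact (lt_min_iff.1 hLν).2.false
  have hWδ : ν.real Wᶜ ≤ δ :=
    ENNReal.toReal_le_of_le_ofReal hδ.le (lt_min_iff.1 hLν).1.le
  obtain ⟨g, hgW, hg⟩ := exists_selection hWm hWne
    (fun A A' : Fin L → α => ∑ t, f (A t) (A' t)) (C := L) (fun A A' =>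
      (Finset.abs_sum_le_sum_abs _ _).trans
        ((Finset.sum_le_card_nsmul _ _ 1 fun t _ => hf _ _).trans_eq (by simp)))
  have hint := hg ξ
  rw [hξ.map_fst, hξ.map_snd] at hint
  have hI : ∫ p, ∑ t : Fin L, f (initialBlock p.1 L t) (initialBlock p.2 L t) ∂ξ = L * R := by
    rw [integral_finsetSum]
    · simp only [initialBlock, hξ.integral_coordinate f, Finset.sum_const, Finset.card_univ,
        Fintype.card_fin, nsmul_eq_mul, hR]
    · intro t _
      exact Integrable.of_bound (measurable_coordinates f t).aestronglyMeasurable 1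
        (Eventually.of_forall fun p => hf _ _)
  rw [hI] at hint
  -- Of the `3 * δ`, selection costs `2 * δ` and one `δ` is slack for a strict inequality. A fourth
  -- pays for the offset error, as `2 * L ≤ δ * n k`.
  have havg := (hx.tendsto_block hL0
    (fun A => ∑ t : Fin L, f (A t) (initialBlock (g A) L t))).eventually_const_lt
    (u := L * R - 3 * δ * L) (by nlinarith)
  have hlarge := (tendsto_natCast_atTop_atTop.comp hn.tendsto_atTop).eventually_ge_atTop
    (2 * L / δ : ℝ)
  have hpos := hn.tendsto_atTop.eventually_gt_atTop 0
  refine ⟨L, fun N => ?_⟩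
  obtain ⟨k, ⟨⟨hk1, hk2⟩, hk3⟩, hkN⟩ :=
    (((havg.and hlarge).and hpos).and (eventually_ge_atTop N)).exists
  let G : ℕ → ℕ → α := fun b => g (initialBlock (shift^[b] x) L)
  obtain ⟨r, hr⟩ := exists_offset (h := fun i a => f (x i) a) (fun i a => hf _ _) G hL0 (n k)
  refine ⟨k, hkN, tile G L r, ?_, ?_⟩
  · have hk3' : (0 : ℝ) < n k := by exact_mod_cast hk3
    rw [smul_eq_mul, one_div, ← div_eq_inv_mul, lt_div_iff₀ hk3'] at hk1
    have heq : ∀ b, ∑ t : Fin L, f (initialBlock (shift^[b] x) L t)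
        (initialBlock (g (initialBlock (shift^[b] x) L)) L t)
        = ∑ t ∈ Finset.range L, f (x (b + t)) (G b t) := by
      intro b
      rw [Finset.sum_range]
      simp [initialBlock, G]
    simp only [heq] at hk1
    rw [Function.comp_apply, div_le_iff₀ hδ] at hk2
    have h1 : L * ((R - 4 * δ) * n k)
        ≤ L * ∑ i ∈ Finset.range (n k), f (x i) (tile G L r i) := by
      nlinarith
    exact le_of_mul_le_mul_left h1 hL0'
  · intro m hm B a c hac
    refine abs_discrepancy_le_of_blocks ν B (r := r) hL0 (by positivity) (fun b hb => ?_) hac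
    rw [← discrepancy_range_shift, Finset.range_eq_Ico]
    have h1 := abs_discrepancy_sub_le ν B (z := shift^[b] (tile G L r)) (w := G b) (a := 0)
      (b := L) fun i _ hi => by rw [shift_iterate_apply, tile_apply G hb hi]
    have h2 : |discrepancy ν B (Finset.Ico 0 L) (G b)| ≤ δ * L := by
      rw [← Finset.range_eq_Ico]
      exact hgW _ m hm B
    have h3 : (m : ℝ) ≤ s := by exact_mod_cast hm
    rw [div_le_iff₀ hδ] at hLs
    rw [abs_le] at h1 h2 ⊢
    constructor <;> linarith

end Stage

/-! ### Gluing the scales into one generic sequence. -/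

section Gluing

theorem exists_stage {start : ℕ → ℕ} (h0 : start 0 = 0) (hmono : StrictMono start) :
    ∃ st : ℕ → ℕ, (∀ i, start (st i) ≤ i) ∧ (∀ i, i < start (st i + 1)) ∧
      (∀ s i, start s ≤ i → i < start (s + 1) → st i = s) ∧
      Tendsto st atTop atTop := by
  have hex : ∀ i, ∃ s, i < start (s + 1) := fun i => ⟨i, hmono.le_apply (x := i + 1)⟩
  have hlow : ∀ i, start (Nat.find (hex i)) ≤ i := by
    intro i
    rcases Nat.eq_zero_or_eq_succ_pred (Nat.find (hex i)) with h | h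
    · rw [h, h0]; exact Nat.zero_le _
    · have := Nat.find_min (hex i) (m := (Nat.find (hex i)).pred) (by omega)
      rw [← Nat.succ_eq_add_one, ← h] at this
      omega
  refine ⟨fun i => Nat.find (hex i), hlow, fun i => Nat.find_spec (hex i), fun s i hs hi => ?_, ?_⟩
  · have h1 := hmono.lt_iff_lt.1 (hs.trans_lt (Nat.find_spec (hex i)))
    have h2 := hmono.lt_iff_lt.1 ((hlow i).trans_lt hi)
    change Nat.find (hex i) = s
    omega
  · refine tendsto_atTop.2 fun s => ?_
    filter_upwards [eventually_ge_atTop (start s)] with i hi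
    exact Nat.lt_succ_iff.1 (hmono.lt_iff_lt.1 (hi.trans_lt (Nat.find_spec (hex i))))

variable {α : Type*} [MeasurableSpace α]

/-- Writing the rate as `ρ (st i)` turns the main term into a Cesàro sum; `e` is a fixed cost per
stage. -/
theorem abs_discrepancy_range_le_of_stages (ν : Measure (ℕ → α)) {start st : ℕ → ℕ}
    (h0 : start 0 = 0) (hmono : StrictMono start)
    (hst : ∀ s i, start s ≤ i → i < start (s + 1) → st i = s) {y : ℕ → α} {m : ℕ} (B : Fin m → α)
    {ρ e : ℕ → ℝ}
    (h : ∀ s c, start s ≤ c → c ≤ start (s + 1) →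
      |discrepancy ν B (Finset.Ico (start s) c) y| ≤ ρ s * (c - start s : ℝ) + e s) (s : ℕ) :
    ∀ c, start s ≤ c → c ≤ start (s + 1) → |discrepancy ν B (Finset.range c) y|
      ≤ ∑ i ∈ Finset.range c, ρ (st i) + ∑ j ∈ Finset.range (s + 1), e j := by
  have hconst : ∀ s c, start s ≤ c → c ≤ start (s + 1) →
      ∑ i ∈ Finset.Ico (start s) c, ρ (st i) = ρ s * (c - start s : ℝ) := by
    intro s c hc hc'
    rw [Finset.sum_congr rfl fun i hi => ?_, Finset.sum_const, Nat.card_Ico, nsmul_eq_mul,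
      Nat.cast_sub hc, mul_comm]
    rw [Finset.mem_Ico] at hi
    rw [hst s i hi.1 (hi.2.trans_le hc')]
  induction s with
  | zero =>
    intro c hc hc'
    have h1 := h 0 c hc hc'
    rw [← hconst 0 c hc hc', h0, ← Finset.range_eq_Ico] at h1
    simpa using h1
  | succ s ih =>
    intro c hc hc'
    have h1 := ih (start (s + 1)) (hmono (Nat.lt_succ_self s)).le le_rfl
    have h2 := h (s + 1) c hc hc'
    rw [← hconst _ c hc hc'] at h2
    rw [Finset.range_eq_Ico, discrepancy_Ico_add ν B y (Nat.zero_le _) hc,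
      ← Finset.sum_Ico_consecutive _ (Nat.zero_le _) hc, Finset.sum_range_succ _ (s + 1),
      ← Finset.range_eq_Ico]
    refine (abs_add_le _ _).trans ?_
    linarith

theorem semiGeneratesAlong_id_of_discrepancy {ν : Measure (ℕ → α)} {y : ℕ → α}
    (h : ∀ m, ∀ B : Fin m → α, Tendsto (fun n : ℕ => |discrepancy ν B (Finset.range n) y| / n)
      atTop (𝓝 0)) : SemiGeneratesAlong y ν id := by
  intro m _ B
  rw [tendsto_iff_dist_tendsto_zero]
  refine (h m B).congr' ?_
  filter_upwards [eventually_gt_atTop 0] with n hn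
  have hn' : (0 : ℝ) < n := by exact_mod_cast hn
  rw [Real.dist_eq, discrepancy, Finset.sum_sub_distrib, ← occurrences_eq_sum, Finset.sum_const,
    Finset.card_range, nsmul_eq_mul]
  nth_rewrite 2 [← abs_of_pos hn']
  rw [← abs_div]
  congr 1
  simp only [id]
  field_simp

variable [Fintype α] [MeasurableSingletonClass α]

/-- A sequence generic for `ν` whose correlation with `x` is, infinitely often along `n`, almost
as large as a prescribed joining predicts. -/
theorem exists_generic_tracking {x : ℕ → α} {μ ν : Measure (ℕ → α)} {n : ℕ → ℕ}
    (hn : StrictMono n) (hx : SemiGeneratesAlong x μ n) (hν : IsErgodicMeasure shift ν)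
    {ξ : Measure ((ℕ → α) × (ℕ → α))} (hξ : IsJoining ξ μ ν) {f : α → α → ℝ}
    (hf : ∀ a b, |f a b| ≤ 1) :
    ∃ y : ℕ → α, SemiGeneratesAlong y ν id ∧ ∀ ε > 0, ∃ᶠ k in atTop,
      (∫ p, f (p.1 0) (p.2 0) ∂ξ - ε) * n k ≤ ∑ i ∈ Finset.range (n k), f (x i) (y i) := by
  have hνp := hν.isProbabilityMeasure
  set R := ∫ p, f (p.1 0) (p.2 0) ∂ξ
  choose L k hk z htrack hreg using fun s : ℕ =>
    exists_tracking hn hx hν hξ hf s (δ := 1 / (s + 1)) (by positivity)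
  -- `A s` dominates the fixed costs up to stage `s` for block lengths at most `s`. `next` makes
  -- both the past and `A (s + 1)` at most a fraction `1 / (s + 1)` of `start (s + 1)`.
  let A : ℕ → ℕ := fun s => ∑ j ∈ Finset.range (s + 1), (2 * L j + s)
  let next : ℕ → ℕ → ℕ := fun s N => (s + 1) * (N + A (s + 1)) + N + s + 1
  obtain ⟨start, h0, hsucc⟩ : ∃ start : ℕ → ℕ, start 0 = 0 ∧
      ∀ s, start (s + 1) = n (k s (next s (start s))) :=
    ⟨fun s => Nat.rec 0 (fun s N => n (k s (next s N))) s, rfl, fun _ => rfl⟩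
  have hge : ∀ s, next s (start s) ≤ start (s + 1) := fun s => by
    rw [hsucc]
    exact (hk s _).trans hn.le_apply
  have hmono : StrictMono start := strictMono_nat_of_lt_succ fun s => by
    have := hge s
    simp only [next] at this
    omega
  obtain ⟨st, hst1, hst1', hst2, hst3⟩ := exists_stage h0 hmono
  let w : ℕ → ℕ → α := fun s => z s (next s (start s))
  let y : ℕ → α := fun i => w (st i) i
  have hy : ∀ s i, start s ≤ i → i < start (s + 1) → y i = w s i := fun s i h1 h2 => by
    simp only [y, hst2 s i h1 h2]
  refine ⟨y, semiGeneratesAlong_id_of_discrepancy fun m B => ?_, fun ε hε => ?_⟩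
  -- Stages before `m` do not control blocks of length `m`; the trivial rate `1` there does not
  -- affect the limit.
  · let ρ : ℕ → ℝ := fun s => if s < m then 1 else 2 * (1 / (s + 1))
    let e : ℕ → ℝ := fun s => 2 * L s + m
    have hρ : Tendsto (fun i => ρ (st i)) atTop (𝓝 0) := by
      have h1 : Tendsto ρ atTop (𝓝 0) := by
        have := (tendsto_one_div_add_atTop_nhds_zero_nat (𝕜 := ℝ)).const_mul 2
        rw [mul_zero] at this
        refine this.congr' ?_
        filter_upwards [eventually_ge_atTop m] with s hs
        simp [ρ, not_lt.2 hs]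
      exact h1.comp hst3
    have hstage : ∀ s c, start s ≤ c → c ≤ start (s + 1) →
        |discrepancy ν B (Finset.Ico (start s) c) y| ≤ ρ s * (c - start s : ℝ) + e s := by
      intro s c hc hc'
      by_cases hs : s < m
      · have h1 := abs_discrepancy_le_card ν B (Finset.Ico (start s) c) y
        rw [Nat.card_Ico, Nat.cast_sub hc] at h1
        have h2 : 0 ≤ e s := by positivity
        simp only [ρ, hs, if_true]
        linarith
      · have h1 := hreg s (next s (start s)) m (not_lt.1 hs) B (start s) c hc
        have h2 := abs_discrepancy_sub_le ν B (z := y) (w := w s) (a := start s) (b := c)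
          fun i hi hic => hy s i hi (hic.trans_le hc')
        simp only [ρ, hs, if_false, e]
        rw [abs_le] at h1 h2 ⊢
        constructor <;> linarith
    have hbound := abs_discrepancy_range_le_of_stages ν h0 hmono hst2 B hstage
    have hces := hρ.cesaro
    have hinv : Tendsto (fun c => 1 / (st c : ℝ)) atTop (𝓝 0) :=
      tendsto_one_div_atTop_nhds_zero_nat.comp hst3
    have hlim := hces.add hinv
    rw [add_zero] at hlim
    refine squeeze_zero' (Eventually.of_forall fun c => by positivity) ?_ hlim
    filter_upwards [hst3.eventually_ge_atTop (max m 1), eventually_gt_atTop 0] with c hc hc0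
    have hcm : m ≤ st c := (le_max_left _ _).trans hc
    have hc1 : 1 ≤ st c := (le_max_right _ _).trans hc
    have hc0' : (0 : ℝ) < c := by exact_mod_cast hc0
    have hc1' : (0 : ℝ) < st c := by exact_mod_cast hc1
    have h1 := hbound (st c) c (hst1 c) (hst1' c).le
    have h2 : ∑ j ∈ Finset.range (st c + 1), e j ≤ A (st c) := by
      simp only [A, e]
      push_cast
      refine Finset.sum_le_sum fun j _ => ?_
      gcongr
    have h3 : st c * A (st c) ≤ c := by
      obtain ⟨s, hs⟩ : ∃ s, st c = s + 1 := ⟨st c - 1, by omega⟩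
      have h4 := hge s
      have h5 := hst1 c
      rw [hs] at h5 ⊢
      simp only [next] at h4
      nlinarith
    have h3' : (st c : ℝ) * A (st c) ≤ c := by exact_mod_cast h3
    rw [div_le_iff₀ hc0', add_mul, mul_assoc, mul_comm _ (c : ℝ), inv_mul_cancel_left₀ hc0'.ne']
    have h6 : (A (st c) : ℝ) ≤ 1 / (st c : ℝ) * c := by
      rw [div_mul_eq_mul_div, one_mul, le_div_iff₀ hc1']
      linarith
    linarith
  · rw [frequently_atTop]
    intro N
    -- With `δ = 1 / (s + 1)`, tracking loses `4 * δ` and overwriting the positions before `start s`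
    -- loses `2 * δ`.
    obtain ⟨s₀, hs₀⟩ := exists_nat_gt (6 / ε)
    let s := max s₀ N
    refine ⟨k s (next s (start s)), ?_, ?_⟩
    · have h1 : N ≤ s := le_max_right _ _
      have h2 : s ≤ next s (start s) := by simp only [next]; omega
      exact (h1.trans h2).trans (hk s _)
    · have h1 := htrack s (next s (start s))
      rw [← hsucc] at h1 ⊢
      set c := start (s + 1)
      have hle : start s ≤ c := (hmono (Nat.lt_succ_self s)).le
      have hterm : ∀ i ∈ Finset.range c, f (x i) (w s i) - (if i < start s then 2 else 0)
          ≤ f (x i) (y i) := by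
        intro i hi
        split_ifs with his
        · have h2 := abs_le.1 (hf (x i) (w s i))
          have h3 := abs_le.1 (hf (x i) (y i))
          linarith
        · rw [hy s i (not_lt.1 his) (Finset.mem_range.1 hi), sub_zero]
      have hsum := Finset.sum_le_sum hterm
      rw [Finset.sum_sub_distrib, ← Finset.sum_filter, Finset.sum_const, nsmul_eq_mul] at hsum
      have hcard : (Finset.filter (fun i => i < start s) (Finset.range c)).card ≤ start s :=
        (Finset.card_le_card fun i hi => Finset.mem_range.2 (Finset.mem_filter.1 hi).2).trans_eq
          (Finset.card_range _)
      have hcard' : ((Finset.filter (fun i => i < start s) (Finset.range c)).card : ℝ)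
        ≤ start s := by exact_mod_cast hcard
      have hge' : (s + 1) * start s ≤ c := by
        have h4 := hge s
        simp only [next] at h4
        nlinarith
      have hge'' : ((s : ℝ) + 1) * start s ≤ c := by exact_mod_cast hge'
      have hs0 : (0 : ℝ) < (s : ℝ) + 1 := by positivity
      have h5 : (start s : ℝ) ≤ 1 / (s + 1) * c := by
        rw [div_mul_eq_mul_div, one_mul, le_div_iff₀ hs0]
        linarith
      have h6 : 6 * (1 / ((s : ℝ) + 1)) ≤ ε := by
        rw [mul_one_div, div_le_iff₀ hs0]
        rw [div_lt_iff₀ hε] at hs₀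
        have : (s₀ : ℝ) ≤ s := by exact_mod_cast le_max_left _ _
        nlinarith
      have h7 : 6 * (1 / ((s : ℝ) + 1)) * c ≤ ε * c := by gcongr
      simp only [w] at hsum
      linarith

end Gluing

/-! ### From correlation of measures to weak correlation of sequences. -/

section Backward

variable {K : Finset ℂ}

theorem exists_weaklyCorrelated_of_correlated (hK : ∀ z ∈ K, ‖z‖ ≤ 1) {x : ℕ → K}
    {μ ν : Measure (ℕ → K)} (hμ : IsInvariantMeasure shift μ) (hx : SemiGenerates x μ)
    (hν : IsErgodicMeasure shift ν) (h : MeasuresCorrelated μ ν) :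
    ∃ y : ℕ → K, IsGeneric shift y ν ∧
      WeaklyCorrelated (fun i => (x i : ℂ)) (fun i => (y i : ℂ)) := by
  have hK' : ∀ z : K, ‖(z : ℂ)‖ ≤ 1 := fun z => hK z z.2
  have := hμ.isProbabilityMeasure
  have := hν.isProbabilityMeasure
  obtain ⟨n, hn, hxn⟩ := hx
  obtain ⟨ξ, hξ, hne⟩ := exists_joiningCorr_ne_zero h
  have := hξ.invariant.isProbabilityMeasure
  have hpos : 0 < ‖joiningCorr ξ μ ν‖ := norm_pos_iff.2 hne
  -- Rotating the covariance onto the positive axis reduces the problem to maximizing a real score.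
  obtain ⟨u, hu, huj⟩ : ∃ u : ℂ, ‖u‖ = 1 ∧ (u * joiningCorr ξ μ ν).re = ‖joiningCorr ξ μ ν‖ := by
    refine ⟨conj (joiningCorr ξ μ ν) / ‖joiningCorr ξ μ ν‖, ?_, ?_⟩
    · rw [norm_div, RCLike.norm_conj, Complex.norm_real, norm_norm, div_self hpos.ne']
    · rw [div_mul_eq_mul_div, mul_comm, Complex.mul_conj', ← Complex.ofReal_pow,
        ← Complex.ofReal_div, Complex.ofReal_re, sq, mul_div_assoc, div_self hpos.ne', mul_one]
  let f : K → K → ℝ := fun a b => (u * (a * conj (b : ℂ))).re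
  have hf : ∀ a b, |f a b| ≤ 1 := fun a b => by
    refine (Complex.abs_re_le_norm _).trans ?_
    rw [norm_mul, norm_mul, hu, one_mul, RCLike.norm_conj]
    exact mul_le_one₀ (hK' a) (norm_nonneg _) (hK' b)
  obtain ⟨y, hy, htrack⟩ := exists_generic_tracking hn hxn hν hξ hf
  refine ⟨y, hy.isGeneric, ?_⟩
  have hR : ∫ p, f (p.1 0) (p.2 0) ∂ξ
      = (u * ∫ p, (p.1 0 : ℂ) * conj (p.2 0 : ℂ) ∂ξ).re := by
    have hint : Integrable (fun p : (ℕ → K) × (ℕ → K) =>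
        u * ((p.1 0 : ℂ) * conj (p.2 0 : ℂ))) ξ := by
      refine Integrable.of_bound (Measurable.aestronglyMeasurable ?_) 1
        (Eventually.of_forall fun p => ?_)
      · have h1 : Measurable fun p : (ℕ → K) × (ℕ → K) => (p.1 0 : ℂ) :=
          measurable_subtype_coe.comp ((measurable_pi_apply 0).comp measurable_fst)
        have h2 : Measurable fun p : (ℕ → K) × (ℕ → K) => (p.2 0 : ℂ) :=
          measurable_subtype_coe.comp ((measurable_pi_apply 0).comp measurable_snd)
        exact (h1.mul (Complex.continuous_conj.measurable.comp h2)).const_mul u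
      · rw [norm_mul, norm_mul, hu, one_mul, RCLike.norm_conj]
        exact mul_le_one₀ (hK' _) (norm_nonneg _) (hK' _)
    rw [← integral_const_mul]
    exact integral_re hint
  have hmean : Tendsto (fun k => (u * (((1 / (n k : ℝ)) • ∑ i ∈ Finset.range (n k), (x i : ℂ))
      * ((1 / (n k : ℝ)) • ∑ i ∈ Finset.range (n k), conj (y i : ℂ)))).re) atTop
      (𝓝 (u * ((∫ z, (z 0 : ℂ) ∂μ) * ∫ z, conj (z 0 : ℂ) ∂ν)).re) := by
    have h1 := hxn.tendsto_continuous (firstSymbol K).continuous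
    have h2 := (hy.tendsto_continuous (star (firstSymbol K)).continuous).comp hn.tendsto_atTop
    refine (Complex.continuous_re.tendsto _).comp (((h1.mul h2).const_mul u).congr fun k => ?_)
    simp [firstSymbol]
  have hfreq : ∃ᶠ k in atTop, ‖joiningCorr ξ μ ν‖ / 2
      ≤ ‖blockCorr (initialBlock (fun i => (x i : ℂ)) (n k))
        (initialBlock (fun i => (y i : ℂ)) (n k))‖ := by
    -- One quarter is lost in tracking and one in the product of means, leaving half.
    have hε : 0 < ‖joiningCorr ξ μ ν‖ / 4 := by positivity
    refine ((htrack _ hε).and_eventually ((hmean.eventually_lt_const (lt_add_of_pos_right _ hε)).and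
      (hn.tendsto_atTop.eventually_gt_atTop 0))).mono ?_
    rintro k ⟨h1, h2, h3⟩
    have h3' : (0 : ℝ) < n k := by exact_mod_cast h3
    have hnorm : ∀ c : ℂ, (u * c).re ≤ ‖c‖ := fun c =>
      (Complex.re_le_norm _).trans_eq (by rw [norm_mul, hu, one_mul])
    refine le_trans ?_ (hnorm _)
    rw [blockCorr_initialBlock, mul_sub, Complex.sub_re]
    have h4 : (u * ((1 / (n k : ℝ)) • ∑ i ∈ Finset.range (n k), (x i : ℂ) * conj (y i : ℂ))).re
        = (∑ i ∈ Finset.range (n k), f (x i) (y i)) / n k := by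
      rw [mul_smul_comm, Complex.real_smul, Complex.re_ofReal_mul, Finset.mul_sum, Complex.re_sum,
        one_div, inv_mul_eq_div]
    rw [h4]
    rw [← le_div_iff₀ h3', hR] at h1
    have h5 := congrArg (fun c => (u * c).re) (joiningCorr.eq_1 ξ μ ν)
    simp only [mul_sub, Complex.sub_re] at h5
    linarith
  refine (half_pos hpos).trans_le (le_limsup_of_frequently_le
    (hn.tendsto_atTop.frequently hfreq) ?_)
  exact isBoundedUnder_of ⟨2, fun k => norm_blockCorr_le (fun i => hK' _) (fun i => hK' _) k⟩

end Backward

end SeqCorr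

theorem theorem4p2 (K : Finset ℂ) (hK : ∀ z ∈ K, ‖z‖ ≤ 1) (x : ℕ → K) :
    (∃ y : ℕ → K,
        (∃ ν : Measure (ℕ → K),
          SeqCorr.IsErgodicMeasure SeqCorr.shift ν ∧ SeqCorr.IsGeneric SeqCorr.shift y ν) ∧
        SeqCorr.WeaklyCorrelated (fun i => (x i : ℂ)) (fun i => (y i : ℂ))) ↔
      ∃ μ : Measure (ℕ → K),
        SeqCorr.IsInvariantMeasure SeqCorr.shift μ ∧ SeqCorr.SemiGenerates x μ ∧
        ∃ ν : Measure (ℕ → K),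
          SeqCorr.IsErgodicMeasure SeqCorr.shift ν ∧ SeqCorr.MeasuresCorrelated μ ν := by
  constructor
  · rintro ⟨y, ⟨ν, hν, hy⟩, hxy⟩
    obtain ⟨μ, hμ, hx, hcorr⟩ := SeqCorr.exists_correlated_of_weaklyCorrelated hK hν hy hxy
    exact ⟨μ, hμ, hx, ν, hν, hcorr⟩
  · rintro ⟨μ, hμ, hx, ν, hν, hcorr⟩
    obtain ⟨y, hy, hxy⟩ := SeqCorr.exists_weaklyCorrelated_of_correlated hK hμ hx hν hcorr
    exact ⟨y, ⟨ν, hν, hy⟩, hxy⟩
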